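/- Let $d\in(-\tfrac12,\tfrac12)\setminus\{0\}$. The integral equations $$q_1(t)=\frac{\sin(\pi d)}{\pi}\int_0^\infty\frac{e^{-r}}{r+t}\,q_1(r)\,dr+1,\qquad p_1(t)=-\frac{\sin(\pi d)}{\pi}\int_0^\infty\frac{e^{-r}}{r+t}\,p_1(r)\,dr+1,\qquad t>0,$$ have unique solutions $q_1,p_1:(0,\infty)\to\mathbb R$ such that $q_1-1,\;p_1-1\in L^2(0,\infty)$. The constants $$\lambda_0=\int_0^\infty q_1(\tau)e^{-\tau}\,d\tau,\qquad \mu_0=\int_0^\infty p_1(\tau)e^{-\tau}\,d\tau$$ are well defined (the integrals converge absolutely) and are given by $$\lambda_0=\frac{\pi}{\sin(\pi d)}\,d(1+d),\qquad \mu_0=\frac{\pi}{\sin(\pi d)}\,d(1-d).$$ -/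

import Mathlib

open MeasureTheory Set

/-- `f` solves, on the half-line `t > 0`, the integral equation
`f(t) = κ ∫₀^∞ e^{-r} / (r + t) f(r) dr + 1` in the class of functions with `f - 1 ∈ L²(0, ∞)`.
(For such `f` the integrand is Lebesgue integrable for every `t > 0`, as both `r ↦ e^{-r} / (r + t)`
and `f - 1` are square integrable and the former is also integrable.
Only the values of `f` on `(0, ∞)` matter.) -/
def IsHalfLineSolution (κ : ℝ) (f : ℝ → ℝ) : Prop :=
  MemLp (fun t => f t - 1) 2 (volume.restrict (Ioi (0 : ℝ))) ∧
    ∀ t : ℝ, 0 < t → f t = κ * (∫ r in Ioi (0 : ℝ), Real.exp (-r) / (r + t) * f r) + 1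

/-- `f` is the unique solution: it is a solution, and every solution agrees with it at every
point of `(0, ∞)`. -/
def IsUniqueHalfLineSolution (κ : ℝ) (f : ℝ → ℝ) : Prop :=
  IsHalfLineSolution κ f ∧ ∀ g : ℝ → ℝ, IsHalfLineSolution κ g → EqOn g f (Ioi (0 : ℝ))

/-! Uniqueness: the kernel `1 / (r + t)` has norm at most `π` on `L²(0, ∞)` by Schur's test
(`lintegral_carleman_le`), and `|sin (π d)| < 1`, so the difference of two solutions is a fixed
point of a strict contraction.

Existence is by an explicit formula, `besselSolution`: `√(t / π)` times the integral of the Gaussian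
`e ^ (-t s²)` against the weight `h = besselWeight d`. Applying the kernel yields again a Gaussian
integral (`integral_kernel_mul_besselSolution`), whose weight times `sin (π d) / π` is the even part
of `h` minus `1` (`integral_besselWeight_resolvent`, a residue computation after substituting `v = e
^ (2 arsinh s)`). A Gaussian sees only the even part, and the constant `1` integrates to the
inhomogeneous term.

Integrating the formula against `e ^ (-r)` reduces the constant to a Beta integral
(`integral_besselWeight_div_cube`). The second equation is the first with `d` replaced by `-d`. -/

/-! ### Gamma and Beta integrals over the half-line. -/

theorem integrableOn_rpow_mul_exp_neg_mul {x b : ℝ} (hx : 0 < x) (hb : 0 < b) :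
    IntegrableOn (fun v : ℝ => v ^ (x - 1) * Real.exp (-(b * v))) (Ioi 0) := by
  -- The Bochner integral of a non-integrable function is `0`, so a nonzero value proves
  -- integrability.
  refine Integrable.of_integral_ne_zero ?_
  rw [Real.integral_rpow_mul_exp_neg_mul_Ioi hx hb]
  have := Real.Gamma_pos_of_pos hx
  positivity

/-- The kernel `(u, v) ↦ u ^ (x + y - 1) v ^ (x - 1) e ^ (-u (a + v))` whose two iterated integrals
give Euler's Beta integral over the half-line. -/
theorem integrable_betaKernel {x y a : ℝ} (hx : 0 < x) (hy : 0 < y) (ha : 0 < a) :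
    Integrable (fun p : ℝ × ℝ => p.1 ^ (x + y - 1) * Real.exp (-(a * p.1)) *
      (p.2 ^ (x - 1) * Real.exp (-(p.1 * p.2))))
      ((volume.restrict (Ioi 0)).prod (volume.restrict (Ioi 0))) := by
  rw [integrable_prod_iff (by fun_prop)]
  constructor
  · filter_upwards [ae_restrict_mem measurableSet_Ioi] with u hu
    exact (integrableOn_rpow_mul_exp_neg_mul hx hu).const_mul _
  · refine ((integrableOn_rpow_mul_exp_neg_mul hy ha).mul_const (Real.Gamma x)).congr ?_
    filter_upwards [ae_restrict_mem measurableSet_Ioi] with u hu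
    have hu : 0 < u := hu
    rw [setIntegral_congr_fun (g := fun v => (u ^ (x + y - 1) * Real.exp (-(a * u))) *
      (v ^ (x - 1) * Real.exp (-(u * v)))) measurableSet_Ioi, integral_const_mul,
      Real.integral_rpow_mul_exp_neg_mul_Ioi hx hu]
    · rw [one_div, Real.inv_rpow hu.le, ← Real.rpow_neg hu.le,
        show y - 1 = (x + y - 1) + -x by ring, Real.rpow_add hu]
      ring
    · intro v hv
      have hv : 0 < v := hv
      exact Real.norm_of_nonneg (by positivity)

theorem integral_betaKernel_left {x y a v : ℝ} (hx : 0 < x) (hy : 0 < y) (ha : 0 < a)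
    (hv : 0 < v) :
    ∫ u in Ioi (0 : ℝ), u ^ (x + y - 1) * Real.exp (-(a * u)) *
      (v ^ (x - 1) * Real.exp (-(u * v))) =
    Real.Gamma (x + y) * (v ^ (x - 1) / (a + v) ^ (x + y)) := by
  have h : ∀ u : ℝ, u ^ (x + y - 1) * Real.exp (-(a * u)) * (v ^ (x - 1) * Real.exp (-(u * v))) =
      v ^ (x - 1) * (u ^ (x + y - 1) * Real.exp (-((a + v) * u))) := fun u => by
    rw [show -((a + v) * u) = -(a * u) + -(u * v) by ring, Real.exp_add]; ring
  simp_rw [h]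
  rw [integral_const_mul, Real.integral_rpow_mul_exp_neg_mul_Ioi (by positivity) (by positivity),
    one_div, Real.inv_rpow (by positivity)]
  ring

theorem integrableOn_rpow_div_add_rpow {x y a : ℝ} (hx : 0 < x) (hy : 0 < y) (ha : 0 < a) :
    IntegrableOn (fun v : ℝ => v ^ (x - 1) / (a + v) ^ (x + y)) (Ioi 0) := by
  have h := (integrable_betaKernel hx hy ha).integral_prod_right.const_mul (Real.Gamma (x + y))⁻¹
  refine h.congr ?_
  filter_upwards [ae_restrict_mem measurableSet_Ioi] with v hv
  rw [integral_betaKernel_left hx hy ha hv, inv_mul_cancel_left₀]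
  exact (Real.Gamma_pos_of_pos (by positivity)).ne'

/-- Euler's Beta integral over the half-line. -/
theorem integral_rpow_div_add_rpow {x y a : ℝ} (hx : 0 < x) (hy : 0 < y) (ha : 0 < a) :
    ∫ v in Ioi (0 : ℝ), v ^ (x - 1) / (a + v) ^ (x + y) =
      Real.Gamma x * Real.Gamma y / Real.Gamma (x + y) * a ^ (-y) := by
  have hΓ := (Real.Gamma_pos_of_pos (add_pos hx hy)).ne'
  have h := integral_integral_swap (f := fun u v : ℝ => u ^ (x + y - 1) * Real.exp (-(a * u)) *
    (v ^ (x - 1) * Real.exp (-(u * v)))) (integrable_betaKernel hx hy ha)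
  rw [setIntegral_congr_fun measurableSet_Ioi
      (fun v hv => integral_betaKernel_left hx hy ha hv), integral_const_mul] at h
  have h2 : ∀ u ∈ Ioi (0 : ℝ), (∫ v in Ioi (0 : ℝ), u ^ (x + y - 1) * Real.exp (-(a * u)) *
      (v ^ (x - 1) * Real.exp (-(u * v)))) =
      Real.Gamma x * (u ^ (y - 1) * Real.exp (-(a * u))) := fun u hu => by
    have hu : 0 < u := hu
    rw [integral_const_mul, Real.integral_rpow_mul_exp_neg_mul_Ioi hx hu, one_div,
      Real.inv_rpow hu.le, ← Real.rpow_neg hu.le, show y - 1 = (x + y - 1) + -x by ring,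
      Real.rpow_add hu]
    ring
  rw [setIntegral_congr_fun measurableSet_Ioi h2, integral_const_mul,
    Real.integral_rpow_mul_exp_neg_mul_Ioi hy ha, one_div, Real.inv_rpow ha.le,
    ← Real.rpow_neg ha.le] at h
  field_simp
  linarith

theorem integrableOn_rpow_div_add {x a : ℝ} (hx : 0 < x) (hx1 : x < 1) (ha : 0 < a) :
    IntegrableOn (fun v : ℝ => v ^ (x - 1) / (a + v)) (Ioi 0) := by
  simpa using integrableOn_rpow_div_add_rpow hx (sub_pos.2 hx1) ha

theorem integral_rpow_div_add {x a : ℝ} (hx : 0 < x) (hx1 : x < 1) (ha : 0 < a) :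
    ∫ v in Ioi (0 : ℝ), v ^ (x - 1) / (a + v) =
      Real.pi / Real.sin (Real.pi * x) * a ^ (x - 1) := by
  simpa [Real.Gamma_mul_Gamma_one_sub] using integral_rpow_div_add_rpow hx (sub_pos.2 hx1) ha

/-! ### Uniqueness -/

theorem memLp_exp_neg_div_add {t : ℝ} (ht : 0 < t) (p : ENNReal) (hp : p = 1 ∨ p = 2) :
    MemLp (fun r : ℝ => Real.exp (-r) / (r + t)) p (volume.restrict (Ioi 0)) := by
  have hexp : MemLp (fun r : ℝ => t⁻¹ * Real.exp (-r)) p (volume.restrict (Ioi 0)) := by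
    refine MemLp.const_mul ?_ _
    rcases hp with rfl | rfl
    · rw [memLp_one_iff_integrable]
      refine (exp_neg_integrableOn_Ioi 0 (b := 1) one_pos).congr ?_
      simp
    · rw [memLp_two_iff_integrable_sq (by fun_prop)]
      refine (exp_neg_integrableOn_Ioi 0 (b := 2) two_pos).congr ?_
      filter_upwards with r
      rw [sq, ← Real.exp_add]
      ring_nf
  refine hexp.mono (Measurable.aestronglyMeasurable (by fun_prop)) ?_
  filter_upwards [ae_restrict_mem measurableSet_Ioi] with r hr
  have hr : 0 < r := hr
  rw [Real.norm_of_nonneg (by positivity), Real.norm_of_nonneg (by positivity),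
    div_eq_inv_mul]
  gcongr
  linarith

theorem integrableOn_kernel_mul {f : ℝ → ℝ}
    (hf : MemLp (fun t => f t - 1) 2 (volume.restrict (Ioi (0 : ℝ)))) {t : ℝ} (ht : 0 < t) :
    IntegrableOn (fun r => Real.exp (-r) / (r + t) * f r) (Ioi 0) := by
  have h1 := (memLp_exp_neg_div_add ht 2 (Or.inr rfl)).integrable_mul hf
  have h2 := memLp_one_iff_integrable.1 (memLp_exp_neg_div_add ht 1 (Or.inl rfl))
  refine (h1.add h2).congr ?_
  filter_upwards with r
  simp only [Pi.mul_apply, Pi.add_apply]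
  ring

/-- `r ^ (-1/2)` is an eigenfunction of the kernel `1 / (r + t)` with eigenvalue `π / sin (π / 2)`,
hence the choice of Schur weight. -/
theorem lintegral_schur_weight {t : ℝ} (ht : 0 < t) :
    ∫⁻ r in Ioi (0 : ℝ), ENNReal.ofReal (√t / √r / (r + t)) = ENNReal.ofReal Real.pi := by
  have h1 : IntegrableOn (fun r : ℝ => √t * (r ^ ((1 / 2 : ℝ) - 1) / (t + r))) (Ioi 0) :=
    (integrableOn_rpow_div_add (by norm_num) (by norm_num) ht).const_mul _
  have h2 : ∫ r in Ioi (0 : ℝ), √t * (r ^ ((1 / 2 : ℝ) - 1) / (t + r)) = Real.pi := by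
    rw [integral_const_mul, integral_rpow_div_add (by norm_num) (by norm_num) ht]
    have : Real.pi * (1 / 2) = Real.pi / 2 := by ring
    rw [this, Real.sin_pi_div_two, show (1 / 2 : ℝ) - 1 = -(1 / 2) by norm_num,
      Real.rpow_neg ht.le, ← Real.sqrt_eq_rpow]
    have := Real.sqrt_pos.2 ht
    field_simp
  rw [← h2, ofReal_integral_eq_lintegral_ofReal h1]
  · refine setLIntegral_congr_fun measurableSet_Ioi fun r hr => ?_
    have hr : 0 < r := hr
    rw [show (1 / 2 : ℝ) - 1 = -(1 / 2) by norm_num,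
      Real.rpow_neg hr.le, ← Real.sqrt_eq_rpow, add_comm r t]
    congr 1
    ring
  · filter_upwards [ae_restrict_mem measurableSet_Ioi] with r hr
    have hr : 0 < r := hr
    simp only [Pi.zero_apply]
    positivity

/-- Weighted AM-GM: before division by `r + t`, the difference of the two sides is `(a√t - b√r)² /
(√t √r)`. -/
theorem mul_mul_le_schur {a b t r : ℝ} (ht : 0 < t) (hr : 0 < r) :
    2 * (a * (b * (r + t)⁻¹)) ≤ a ^ 2 * (√t / √r / (r + t)) + b ^ 2 * (√r / √t / (t + r)) := by
  have h1 := Real.sqrt_pos.2 ht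
  have h2 := Real.sqrt_pos.2 hr
  have key : 2 * (a * b) ≤ a ^ 2 * (√t / √r) + b ^ 2 * (√r / √t) := by
    have : a ^ 2 * (√t / √r) + b ^ 2 * (√r / √t) - 2 * (a * b) =
        (a * √t - b * √r) ^ 2 / (√t * √r) := by
      field_simp
      ring
    have h3 : 0 ≤ (a * √t - b * √r) ^ 2 / (√t * √r) := by positivity
    linarith
  calc 2 * (a * (b * (r + t)⁻¹)) = 2 * (a * b) * (r + t)⁻¹ := by ring
    _ ≤ (a ^ 2 * (√t / √r) + b ^ 2 * (√r / √t)) * (r + t)⁻¹ := by gcongr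
    _ = _ := by rw [add_comm t r]; ring

/-- Schur's test for the kernel `1 / (r + t)` on the half-line. -/
theorem lintegral_carleman_le {w : ℝ → ℝ} (hw : AEMeasurable w (volume.restrict (Ioi 0))) :
    ∫⁻ t in Ioi (0 : ℝ), ENNReal.ofReal |w t| *
        ∫⁻ r in Ioi (0 : ℝ), ENNReal.ofReal (|w r| * (r + t)⁻¹) ≤
      ENNReal.ofReal Real.pi * ∫⁻ t in Ioi (0 : ℝ), ENNReal.ofReal (w t ^ 2) := by
  have hB : AEMeasurable (Function.uncurry fun t r : ℝ =>
      ENNReal.ofReal (w r ^ 2) * ENNReal.ofReal (√r / √t / (t + r)))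
      ((volume.restrict (Ioi 0)).prod (volume.restrict (Ioi 0))) := by
    have h1 : AEMeasurable (fun p : ℝ × ℝ => ENNReal.ofReal (w p.2 ^ 2))
        ((volume.restrict (Ioi 0)).prod (volume.restrict (Ioi 0))) :=
      (hw.comp_snd.pow_const 2).ennreal_ofReal
    have h2 : Measurable (fun p : ℝ × ℝ => ENNReal.ofReal (√p.2 / √p.1 / (p.1 + p.2))) :=
      Measurable.ennreal_ofReal (by fun_prop)
    exact h1.mul h2.aemeasurable
  have hA : ∀ t ∈ Ioi (0 : ℝ), ∫⁻ r in Ioi (0 : ℝ),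
      ENNReal.ofReal (w t ^ 2) * ENNReal.ofReal (√t / √r / (r + t)) =
      ENNReal.ofReal (w t ^ 2) * ENNReal.ofReal Real.pi := fun t ht => by
    rw [lintegral_const_mul' _ _ ENNReal.ofReal_ne_top, lintegral_schur_weight ht]
  have hmain : 2 * ∫⁻ t in Ioi (0 : ℝ), ENNReal.ofReal |w t| *
        ∫⁻ r in Ioi (0 : ℝ), ENNReal.ofReal (|w r| * (r + t)⁻¹) ≤
      2 * (ENNReal.ofReal Real.pi * ∫⁻ t in Ioi (0 : ℝ), ENNReal.ofReal (w t ^ 2)) := by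
    calc _ = ∫⁻ t in Ioi (0 : ℝ), ∫⁻ r in Ioi (0 : ℝ),
          2 * (ENNReal.ofReal |w t| * ENNReal.ofReal (|w r| * (r + t)⁻¹)) := by
          rw [← lintegral_const_mul' _ _ (by simp)]
          refine lintegral_congr fun t => ?_
          rw [lintegral_const_mul' _ _ (by simp), lintegral_const_mul' _ _ ENNReal.ofReal_ne_top]
      _ ≤ ∫⁻ t in Ioi (0 : ℝ), ∫⁻ r in Ioi (0 : ℝ),
          (ENNReal.ofReal (w t ^ 2) * ENNReal.ofReal (√t / √r / (r + t)) +
          ENNReal.ofReal (w r ^ 2) * ENNReal.ofReal (√r / √t / (t + r))) := by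
          refine setLIntegral_mono' measurableSet_Ioi fun t ht => ?_
          refine setLIntegral_mono' measurableSet_Ioi fun r hr => ?_
          have ht : 0 < t := ht
          have hr : 0 < r := hr
          rw [← ENNReal.ofReal_mul (by positivity), ← ENNReal.ofReal_mul (by positivity),
            ← ENNReal.ofReal_mul (by positivity), ← ENNReal.ofReal_add (by positivity)
            (by positivity), ← ENNReal.ofReal_ofNat 2, ← ENNReal.ofReal_mul (by positivity)]
          refine ENNReal.ofReal_le_ofReal ?_
          simpa using mul_mul_le_schur (a := |w t|) (b := |w r|) ht hr
      _ = (∫⁻ t in Ioi (0 : ℝ), ENNReal.ofReal (w t ^ 2) * ENNReal.ofReal Real.pi) +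
          ∫⁻ t in Ioi (0 : ℝ), ∫⁻ r in Ioi (0 : ℝ),
          ENNReal.ofReal (w r ^ 2) * ENNReal.ofReal (√r / √t / (t + r)) := by
          rw [← setLIntegral_congr_fun measurableSet_Ioi hA, ← lintegral_add_left']
          · refine lintegral_congr fun t => ?_
            rw [← lintegral_add_left']
            exact (Measurable.ennreal_ofReal (by fun_prop)).aemeasurable.const_mul _
          · rw [aemeasurable_congr (g := fun t => ENNReal.ofReal (w t ^ 2) * ENNReal.ofReal Real.pi)
              ((ae_restrict_mem measurableSet_Ioi).mono hA)]
            exact ((hw.pow_const 2).ennreal_ofReal).mul_const _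
      _ = _ := by
          rw [lintegral_lintegral_swap hB, setLIntegral_congr_fun measurableSet_Ioi hA,
            lintegral_mul_const' _ _ ENNReal.ofReal_ne_top]
          ring
  exact (ENNReal.mul_le_mul_iff_right (by simp) (by simp)).1 hmain

theorem eqOn_zero_of_carleman {κ : ℝ} (hκ : |κ| * Real.pi < 1) {w : ℝ → ℝ}
    (hw : MemLp w 2 (volume.restrict (Ioi 0)))
    (h : ∀ t : ℝ, 0 < t → w t = κ * ∫ r in Ioi (0 : ℝ), Real.exp (-r) / (r + t) * w r) :
    EqOn w 0 (Ioi 0) := by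
  set L := ∫⁻ t in Ioi (0 : ℝ), ENNReal.ofReal (w t ^ 2) with hL
  have hfin : L ≠ ⊤ := by
    have := (memLp_two_iff_integrable_sq hw.1).1 hw
    exact (this.lintegral_lt_top).ne
  have hpt : ∀ t ∈ Ioi (0 : ℝ), ENNReal.ofReal |w t| ≤
      ENNReal.ofReal |κ| * ∫⁻ r in Ioi (0 : ℝ), ENNReal.ofReal (|w r| * (r + t)⁻¹) := by
    intro t ht
    have ht : 0 < t := ht
    rw [h t ht, abs_mul, ENNReal.ofReal_mul (abs_nonneg _)]
    gcongr
    rw [← Real.norm_eq_abs, ofReal_norm]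
    refine (enorm_integral_le_lintegral_enorm _).trans ?_
    refine setLIntegral_mono' measurableSet_Ioi fun r hr => ?_
    have hr : 0 < r := hr
    rw [← ofReal_norm]
    refine ENNReal.ofReal_le_ofReal ?_
    rw [norm_mul, Real.norm_eq_abs (w r), Real.norm_of_nonneg (by positivity), mul_comm,
      ← one_div]
    gcongr
    exact Real.exp_le_one_iff.2 (by linarith)
  have hle : L ≤ ENNReal.ofReal (|κ| * Real.pi) * L := by
    calc L ≤ ∫⁻ t in Ioi (0 : ℝ), ENNReal.ofReal |κ| * (ENNReal.ofReal |w t| *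
          ∫⁻ r in Ioi (0 : ℝ), ENNReal.ofReal (|w r| * (r + t)⁻¹)) := by
          refine setLIntegral_mono' measurableSet_Ioi fun t ht => ?_
          rw [← sq_abs, sq, ENNReal.ofReal_mul (abs_nonneg _), mul_left_comm]
          gcongr
          exact hpt t ht
      _ = ENNReal.ofReal |κ| * ∫⁻ t in Ioi (0 : ℝ), (ENNReal.ofReal |w t| *
          ∫⁻ r in Ioi (0 : ℝ), ENNReal.ofReal (|w r| * (r + t)⁻¹)) :=
          lintegral_const_mul' _ _ ENNReal.ofReal_ne_top
      _ ≤ ENNReal.ofReal |κ| * (ENNReal.ofReal Real.pi * L) := by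
          gcongr
          exact lintegral_carleman_le hw.1.aemeasurable
      _ = _ := by rw [ENNReal.ofReal_mul (abs_nonneg _), mul_assoc]
  have hL0 : L = 0 := by
    by_contra h0
    refine absurd hle (not_le.2 ?_)
    calc ENNReal.ofReal (|κ| * Real.pi) * L < 1 * L := by
          rw [ENNReal.mul_lt_mul_iff_left h0 hfin]
          rwa [ENNReal.ofReal_lt_one]
      _ = L := one_mul L
  -- The norm argument gives vanishing only almost everywhere; the equation itself then gives it at
  -- every point.
  have hae : w =ᵐ[volume.restrict (Ioi 0)] 0 := by
    rw [hL, lintegral_eq_zero_iff' ((hw.1.aemeasurable.pow_const 2).ennreal_ofReal)] at hL0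
    filter_upwards [hL0] with t ht
    have : w t ^ 2 ≤ 0 := by simpa using ht
    simpa using le_antisymm this (sq_nonneg _)
  intro t ht
  rw [h t ht, integral_congr_ae (g := fun _ => (0 : ℝ))]
  · simp
  · filter_upwards [hae] with r hr
    simp [hr]

theorem IsHalfLineSolution.eqOn {κ : ℝ} (hκ : |κ| * Real.pi < 1) {f g : ℝ → ℝ}
    (hf : IsHalfLineSolution κ f) (hg : IsHalfLineSolution κ g) : EqOn g f (Ioi 0) := by
  have hw : EqOn (g - f) 0 (Ioi 0) := by
    refine eqOn_zero_of_carleman hκ ?_ fun t ht => ?_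
    · convert! hg.1.sub hf.1 using 1
      ext t
      simp
    · rw [Pi.sub_apply, hg.2 t ht, hf.2 t ht, add_sub_add_right_eq_sub, ← mul_sub,
        ← integral_sub (integrableOn_kernel_mul hg.1 ht) (integrableOn_kernel_mul hf.1 ht)]
      simp only [Pi.sub_apply, mul_sub]
  exact fun t ht => sub_eq_zero.1 (hw ht)

/-! ### The weight in the integral representation of the solution -/

/-- The weight `h` such that `√(t / π) ∫ e ^ (-t s²) h(s) ds` solves the integral equation. -/
noncomputable def besselWeight (d s : ℝ) : ℝ :=
  Real.exp ((1 + 2 * d) * Real.arsinh s) / √(1 + s ^ 2)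

theorem besselWeight_pos (d s : ℝ) : 0 < besselWeight d s := by
  unfold besselWeight; positivity

theorem continuous_besselWeight (d : ℝ) : Continuous (besselWeight d) := by
  unfold besselWeight
  have := Real.continuous_arsinh
  exact Continuous.div (by fun_prop) (by fun_prop) fun s => by positivity

theorem cosh_half_log {v : ℝ} (hv : 0 < v) : Real.cosh (Real.log v / 2) = (v + 1) / (2 * √v) := by
  have h : 0 < √v := Real.sqrt_pos.2 hv
  rw [Real.cosh_eq, Real.exp_neg, ← Real.log_sqrt hv.le, Real.exp_log h]
  field_simp
  rw [Real.sq_sqrt hv.le]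

theorem image_sinh_half_log : (fun v : ℝ => Real.sinh (Real.log v / 2)) '' Ioi 0 = univ := by
  refine eq_univ_of_forall fun s => ⟨Real.exp (2 * Real.arsinh s), Real.exp_pos _, ?_⟩
  simp

theorem integral_eq_integral_sinh_half_log (g : ℝ → ℝ) :
    ∫ s, g s = ∫ v in Ioi (0 : ℝ),
      Real.cosh (Real.log v / 2) / (2 * v) * g (Real.sinh (Real.log v / 2)) := by
  rw [← setIntegral_univ, ← image_sinh_half_log,
    integral_image_eq_integral_abs_deriv_smul (f' := fun v =>
      Real.cosh (Real.log v / 2) / (2 * v)) measurableSet_Ioi]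
  · refine setIntegral_congr_fun measurableSet_Ioi fun v hv => ?_
    have hv : 0 < v := hv
    have := Real.cosh_pos (Real.log v / 2)
    rw [smul_eq_mul, abs_of_nonneg (by positivity)]
  · intro v hv
    have hv : 0 < v := hv
    have h := ((Real.hasDerivAt_log hv.ne').div_const 2).sinh
    convert! h.hasDerivWithinAt using 1
    field_simp
  · intro a ha b hb hab
    have := Real.sinh_injective hab
    exact Real.log_injOn_pos ha hb (by linarith)

/-- The substitution `s = sinh (log v / 2)` turns the exponential of `arsinh` into a power of `v`
and `√(1 + s²)` into `(v + 1) / (2√v)`. -/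
theorem integral_besselWeight_mul (d : ℝ) (Φ : ℝ → ℝ) :
    ∫ s, besselWeight d s * Φ (√(1 + s ^ 2)) =
      ∫ v in Ioi (0 : ℝ), v ^ (d - 1 / 2) / 2 * Φ ((v + 1) / (2 * √v)) := by
  rw [integral_eq_integral_sinh_half_log]
  refine setIntegral_congr_fun measurableSet_Ioi fun v hv => ?_
  have hv : 0 < v := hv
  have h1 : √(1 + Real.sinh (Real.log v / 2) ^ 2) = Real.cosh (Real.log v / 2) := by
    rw [← Real.cosh_arsinh, Real.arsinh_sinh]
  have h2 : Real.exp ((1 + 2 * d) * (Real.log v / 2)) = v ^ (d - 1 / 2) * v := by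
    rw [← Real.rpow_add_one hv.ne', Real.rpow_def_of_pos hv]
    ring_nf
  have := Real.cosh_pos (Real.log v / 2)
  simp only [besselWeight, h1, Real.arsinh_sinh, h2]
  rw [← cosh_half_log hv]
  field_simp

theorem rpow_sub_half_mul {d v : ℝ} (hv : 0 < v) : v ^ (d - 1 / 2) * √v ^ 3 = v ^ (1 + d) := by
  rw [Real.sqrt_eq_rpow, ← Real.rpow_natCast, ← Real.rpow_mul hv.le, ← Real.rpow_add hv]
  congr 1
  push_cast
  ring

/-! ### Rational integrals against the weight. -/

/-- The Beta integral with parameters `2 + d` and `1 - d`; `Γ(2 + d) = (1 + d) d Γ(d)` and the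
reflection formula produce the factor `d (1 + d)`. -/
theorem integral_besselWeight_div_cube {d : ℝ} (hd₁ : -1 < d) (hd₂ : d < 1) (hd₀ : d ≠ 0) :
    ∫ s, besselWeight d s * (1 / √(1 + s ^ 2) ^ 3) =
      2 * (Real.pi / Real.sin (Real.pi * d) * (d * (1 + d))) := by
  rw [integral_besselWeight_mul d fun c => 1 / c ^ 3]
  have h : ∀ v ∈ Ioi (0 : ℝ), v ^ (d - 1 / 2) / 2 * (1 / ((v + 1) / (2 * √v)) ^ 3) =
      4 * (v ^ ((2 + d) - 1) / (1 + v) ^ ((2 + d) + (1 - d))) := fun v hv => by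
    have hv : 0 < v := hv
    rw [show (2 + d) + (1 - d) = (3 : ℕ) by push_cast; ring, Real.rpow_natCast,
      show 2 + d - 1 = 1 + d by ring, ← rpow_sub_half_mul hv, add_comm v 1]
    have := Real.sqrt_pos.2 hv
    field_simp
    ring
  rw [setIntegral_congr_fun measurableSet_Ioi h, integral_const_mul,
    integral_rpow_div_add_rpow (by linarith) (by linarith) one_pos,
    ← Real.Gamma_mul_Gamma_one_sub, show (2 + d) + (1 - d) = (2 : ℕ) + 1 by push_cast; ring,
    Real.Gamma_nat_eq_factorial, show 2 + d = (d + 1) + 1 by ring,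
    Real.Gamma_add_one (by linarith), Real.Gamma_add_one hd₀, Real.one_rpow]
  norm_num [Nat.factorial]
  ring

/-- Split off one power of `v`, leaving terms with numerator `v ^ d`, each integrable when `-1 < d <
0`. For `0 < d < 1` these diverge separately, and `partial_fractions_two` splits off `v²` instead.
-/
theorem partial_fractions_one {A B d v : ℝ} (hv : 0 < v) (hA : 0 < A) (hB : 0 < B) (hA1 : A ≠ 1)
    (hB1 : B ≠ 1) (hAB : A ≠ B) :
    v ^ (1 + d) / ((v + 1) * ((v + A) * (v + B))) =
      -1 / ((A - 1) * (B - 1)) * (v ^ ((1 + d) - 1) / (1 + v)) +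
      -A / ((1 - A) * (B - A)) * (v ^ ((1 + d) - 1) / (A + v)) +
      -B / ((1 - B) * (A - B)) * (v ^ ((1 + d) - 1) / (B + v)) := by
  rw [Real.rpow_sub_one hv.ne']
  have h1 := sub_ne_zero.2 hA1
  have h2 := sub_ne_zero.2 hB1
  have h3 := sub_ne_zero.2 hAB
  have h4 := sub_ne_zero.2 hA1.symm
  have h5 := sub_ne_zero.2 hB1.symm
  have h6 := sub_ne_zero.2 hAB.symm
  rw [← neg_sub A 1, ← neg_sub B 1, ← neg_sub A B]
  field_simp
  ring

theorem partial_fractions_two {A B d v : ℝ} (hv : 0 < v) (hA : 0 < A) (hB : 0 < B) (hA1 : A ≠ 1)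
    (hB1 : B ≠ 1) (hAB : A ≠ B) :
    v ^ (1 + d) / ((v + 1) * ((v + A) * (v + B))) =
      1 / ((A - 1) * (B - 1)) * (v ^ (d - 1) / (1 + v)) +
      A ^ 2 / ((1 - A) * (B - A)) * (v ^ (d - 1) / (A + v)) +
      B ^ 2 / ((1 - B) * (A - B)) * (v ^ (d - 1) / (B + v)) := by
  rw [Real.rpow_sub_one hv.ne', add_comm 1 d, Real.rpow_add_one hv.ne']
  have h1 := sub_ne_zero.2 hA1
  have h2 := sub_ne_zero.2 hB1
  have h3 := sub_ne_zero.2 hAB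
  rw [← neg_sub A 1, ← neg_sub B 1, ← neg_sub A B]
  field_simp
  ring

theorem integral_three_terms {x a b c A B : ℝ} (hx : 0 < x) (hx1 : x < 1) (hA : 0 < A)
    (hB : 0 < B) :
    ∫ v in Ioi (0 : ℝ), (a * (v ^ (x - 1) / (1 + v)) + b * (v ^ (x - 1) / (A + v)) +
      c * (v ^ (x - 1) / (B + v))) =
    Real.pi / Real.sin (Real.pi * x) * (a + b * A ^ (x - 1) + c * B ^ (x - 1)) := by
  have h1 := integrableOn_rpow_div_add hx hx1 one_pos
  have hA' := integrableOn_rpow_div_add hx hx1 hA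
  have hB' := integrableOn_rpow_div_add hx hx1 hB
  have hsum : IntegrableOn (fun v : ℝ => a * (v ^ (x - 1) / (1 + v)) +
      b * (v ^ (x - 1) / (A + v))) (Ioi 0) := (h1.const_mul a).add (hA'.const_mul b)
  rw [integral_add hsum (hB'.const_mul c), integral_add (h1.const_mul a) (hA'.const_mul b)]
  simp only [integral_const_mul]
  rw [integral_rpow_div_add hx hx1 one_pos, integral_rpow_div_add hx hx1 hA,
    integral_rpow_div_add hx hx1 hB, Real.one_rpow]
  ring

theorem integral_rpow_div_cubic {A B d : ℝ} (hd₁ : -1 < d) (hd₂ : d < 1) (hd₀ : d ≠ 0)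
    (hA : 0 < A) (hB : 0 < B) (hA1 : A ≠ 1) (hB1 : B ≠ 1) (hAB : A ≠ B) :
    ∫ v in Ioi (0 : ℝ), v ^ (1 + d) / ((v + 1) * ((v + A) * (v + B))) =
      Real.pi / Real.sin (Real.pi * d) * (1 / ((A - 1) * (B - 1)) +
        A ^ (1 + d) / ((1 - A) * (B - A)) + B ^ (1 + d) / ((1 - B) * (A - B))) := by
  rcases hd₀.lt_or_gt with hd | hd
  · rw [setIntegral_congr_fun measurableSet_Ioi
      (fun v hv => partial_fractions_one hv hA hB hA1 hB1 hAB),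
      integral_three_terms (by linarith) (by linarith) hA hB, add_sub_cancel_left,
      add_comm 1 d, mul_add Real.pi, mul_one, Real.sin_add_pi, Real.rpow_add_one hA.ne',
      Real.rpow_add_one hB.ne']
    simp only [neg_div, div_neg]
    ring
  · rw [setIntegral_congr_fun measurableSet_Ioi
      (fun v hv => partial_fractions_two hv hA hB hA1 hB1 hAB),
      integral_three_terms hd hd₂ hA hB, add_comm 1 d, Real.rpow_add_one hA.ne',
      Real.rpow_add_one hB.ne', Real.rpow_sub_one hA.ne', Real.rpow_sub_one hB.ne']
    congr 1
    field_simp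

/-- In the variable `v` the denominator is `(v + 1)(v + A)(v + A⁻¹)` with `A = e ^ (2 arsinh σ)`.
The pole at `-1` contributes the `-1`; those at `-A` and `-A⁻¹` contribute the two halves of the
even part of the weight. -/
theorem integral_besselWeight_resolvent {d σ : ℝ} (hd₁ : -1 < d) (hd₂ : d < 1) (hd₀ : d ≠ 0)
    (hsin : Real.sin (Real.pi * d) ≠ 0) :
    Real.sin (Real.pi * d) / Real.pi * (σ ^ 2 * ∫ s, besselWeight d s *
        (1 / (√(1 + s ^ 2) * (σ ^ 2 + √(1 + s ^ 2) ^ 2)))) =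
      (besselWeight d σ + besselWeight d (-σ)) / 2 - 1 := by
  -- At `σ = 0` the three poles coincide, but both sides vanish.
  rcases eq_or_ne σ 0 with rfl | hσ
  · simp [besselWeight]
  set A := Real.exp (2 * Real.arsinh σ) with hA
  have hA0 : 0 < A := Real.exp_pos _
  set E := Real.exp (Real.arsinh σ) with hE
  have hE0 : 0 < E := Real.exp_pos _
  have hAE : A = E ^ 2 := by rw [hA, hE, ← Real.exp_nat_mul]; norm_num
  have hσE : σ = (E - E⁻¹) / 2 := by
    rw [hE, ← Real.exp_neg, ← Real.sinh_eq, Real.sinh_arsinh]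
  have hcE : √(1 + σ ^ 2) = (E + E⁻¹) / 2 := by
    rw [hE, ← Real.exp_neg, ← Real.cosh_eq, Real.cosh_arsinh]
  have hE1 : E ≠ 1 := by
    rw [hE, Ne, Real.exp_eq_one_iff, Real.arsinh_eq_zero_iff]; exact hσ
  have hE2 : E ^ 2 - 1 ≠ 0 := by
    have : (E - 1) * (E + 1) ≠ 0 := mul_ne_zero (sub_ne_zero.2 hE1) (by positivity)
    intro h; apply this; linarith
  have hA1 : A ≠ 1 := by rw [hAE]; exact sub_ne_zero.1 hE2
  have hB1 : A⁻¹ ≠ 1 := by simpa using hA1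
  have hAB : A ≠ A⁻¹ := by
    intro h
    have : A * A = 1 := by nth_rw 2 [h]; exact mul_inv_cancel₀ hA0.ne'
    have h2 : (A - 1) * (A + 1) = 0 := by linarith
    rcases mul_eq_zero.1 h2 with h3 | h3
    · exact hA1 (by linarith)
    · linarith
  rw [integral_besselWeight_mul d fun c => 1 / (c * (σ ^ 2 + c ^ 2))]
  have h : ∀ v ∈ Ioi (0 : ℝ), v ^ (d - 1 / 2) / 2 *
      (1 / ((v + 1) / (2 * √v) * (σ ^ 2 + ((v + 1) / (2 * √v)) ^ 2))) =
      4 * (v ^ (1 + d) / ((v + 1) * ((v + A) * (v + A⁻¹)))) := fun v hv => by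
    have hv : 0 < v := hv
    have hs := Real.sqrt_pos.2 hv
    rw [← rpow_sub_half_mul hv]
    have h4 : (v + A) * (v + A⁻¹) = 4 * v * (σ ^ 2 + ((v + 1) / (2 * √v)) ^ 2) := by
      rw [hσE, hAE, div_pow (v + 1), mul_pow, Real.sq_sqrt hv.le]
      field_simp
      ring
    rw [h4]
    have h5 : 0 < σ ^ 2 + ((v + 1) / (2 * √v)) ^ 2 := by positivity
    generalize σ ^ 2 + ((v + 1) / (2 * √v)) ^ 2 = X at h5
    have h6 : √v ^ 3 = v * √v := by rw [pow_succ, Real.sq_sqrt hv.le]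
    rw [h6]
    field_simp
  rw [setIntegral_congr_fun measurableSet_Ioi h, integral_const_mul,
    integral_rpow_div_cubic hd₁ hd₂ hd₀ hA0 (inv_pos.2 hA0) hA1 hB1 hAB]
  have hw1 : Real.exp ((1 + 2 * d) * Real.arsinh σ) = A ^ (1 + d) * E⁻¹ := by
    rw [hA, ← Real.exp_mul, hE, ← Real.exp_neg, ← Real.exp_add]; ring_nf
  have hw2 : Real.exp ((1 + 2 * d) * -Real.arsinh σ) = A⁻¹ ^ (1 + d) * E := by
    rw [hA, ← Real.exp_neg, ← Real.exp_mul, hE, ← Real.exp_add]; ring_nf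
  simp only [besselWeight, Real.arsinh_neg, neg_sq, hcE, hw1, hw2]
  have hπ := Real.pi_ne_zero
  generalize A ^ (1 + d) = X
  generalize A⁻¹ ^ (1 + d) = Y
  generalize Real.sin (Real.pi * d) = S at hsin
  rw [hσE, hAE]
  have hE3 : 1 - E ^ 2 ≠ 0 := by rw [← neg_sub]; exact neg_ne_zero.2 hE2
  have e1 : ((E ^ 2)⁻¹ - 1) = -(E ^ 2 - 1) / E ^ 2 := by field_simp; ring
  have e2 : ((E ^ 2)⁻¹ - E ^ 2) = -((E ^ 2 - 1) * (E ^ 2 + 1)) / E ^ 2 := by field_simp; ring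
  have e3 : (1 - (E ^ 2)⁻¹) = (E ^ 2 - 1) / E ^ 2 := by field_simp
  have e4 : (E ^ 2 - (E ^ 2)⁻¹) = ((E ^ 2 - 1) * (E ^ 2 + 1)) / E ^ 2 := by field_simp; ring
  have e5 : 1 - E ^ 2 = -(E ^ 2 - 1) := by ring
  have e6 : E - E⁻¹ = (E ^ 2 - 1) / E := by field_simp
  rw [e1, e2, e3, e4, e5, e6]
  generalize E ^ 2 - 1 = Z at hE2
  field_simp
  ring

/-! ### Existence -/

/-- `e ^ (arsinh s) ≤ 2√(1 + s²)` is raised to the power `1 + 2d`, which lies between `0` and `2`;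
hence the constant `4 = 2²`. -/
theorem besselWeight_le {d : ℝ} (hd₁ : -(1 / 2) < d) (hd₂ : d < 1 / 2) (s : ℝ) :
    besselWeight d s ≤ 4 * (1 + s ^ 2) ^ d := by
  have hp : 0 < 1 + s ^ 2 := by positivity
  have hc : 0 < √(1 + s ^ 2) := Real.sqrt_pos.2 hp
  rw [besselWeight, div_le_iff₀ hc]
  have h1 : Real.exp (Real.arsinh s) ≤ 2 * √(1 + s ^ 2) := by
    rw [Real.exp_arsinh]
    have : s ≤ √(1 + s ^ 2) := Real.le_sqrt_of_sq_le (by linarith)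
    linarith
  have h2 : √(1 + s ^ 2) ^ (1 + 2 * d) = (1 + s ^ 2) ^ d * √(1 + s ^ 2) := by
    rw [Real.sqrt_eq_rpow, ← Real.rpow_mul hp.le, ← Real.rpow_add hp]
    congr 1
    ring
  calc Real.exp ((1 + 2 * d) * Real.arsinh s)
      = Real.exp (Real.arsinh s) ^ (1 + 2 * d) := by rw [← Real.exp_mul, mul_comm]
    _ ≤ (2 * √(1 + s ^ 2)) ^ (1 + 2 * d) :=
      Real.rpow_le_rpow (Real.exp_pos _).le h1 (by linarith)
    _ = 2 ^ (1 + 2 * d) * ((1 + s ^ 2) ^ d * √(1 + s ^ 2)) := by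
      rw [Real.mul_rpow two_pos.le hc.le, h2]
    _ ≤ 2 ^ (2 : ℝ) * ((1 + s ^ 2) ^ d * √(1 + s ^ 2)) := by
      gcongr
      · norm_num
      · linarith
    _ = 4 * (1 + s ^ 2) ^ d * √(1 + s ^ 2) := by norm_num; ring

theorem besselWeight_le_sqrt {d : ℝ} (hd₁ : -(1 / 2) < d) (hd₂ : d < 1 / 2) (s : ℝ) :
    besselWeight d s ≤ 4 * √(1 + s ^ 2) := by
  refine (besselWeight_le hd₁ hd₂ s).trans ?_
  rw [Real.sqrt_eq_rpow]
  gcongr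
  nlinarith [sq_nonneg s]

theorem integrable_besselWeight_div_cube {d : ℝ} (hd₁ : -(1 / 2) < d) (hd₂ : d < 1 / 2) :
    Integrable fun s => besselWeight d s * (1 / √(1 + s ^ 2) ^ 3) := by
  refine (integrable_inv_one_add_sq.const_mul 4).mono' ?_ ?_
  · refine Continuous.aestronglyMeasurable ?_
    exact (continuous_besselWeight d).mul
      (Continuous.div (by fun_prop) (by fun_prop) fun s => by positivity)
  · filter_upwards with s
    have hp : 0 < 1 + s ^ 2 := by positivity
    have hc : 0 < √(1 + s ^ 2) := Real.sqrt_pos.2 hp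
    rw [Real.norm_of_nonneg (mul_nonneg (besselWeight_pos d s).le (by positivity))]
    calc besselWeight d s * (1 / √(1 + s ^ 2) ^ 3)
        ≤ 4 * √(1 + s ^ 2) * (1 / √(1 + s ^ 2) ^ 3) := by
          gcongr
          exact besselWeight_le_sqrt hd₁ hd₂ s
      _ = 4 * (√(1 + s ^ 2) ^ 2)⁻¹ := by field_simp
      _ = 4 * (1 + s ^ 2)⁻¹ := by rw [Real.sq_sqrt hp.le]

theorem integrable_exp_mul_besselWeight {d t : ℝ} (hd₁ : -(1 / 2) < d) (hd₂ : d < 1 / 2)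
    (ht : 0 < t) : Integrable fun s => Real.exp (-(t * s ^ 2)) * besselWeight d s := by
  have h0 : Integrable fun s : ℝ => Real.exp (-(t * s ^ 2)) := by
    simpa using integrable_exp_neg_mul_sq ht
  have h2 : Integrable fun s : ℝ => s ^ 2 * Real.exp (-(t * s ^ 2)) := by
    simpa using integrable_rpow_mul_exp_neg_mul_sq ht (s := 2) (by norm_num)
  refine ((h0.add h2).const_mul 4).mono' ?_ ?_
  · exact ((by fun_prop : Continuous fun s : ℝ => Real.exp (-(t * s ^ 2))).mul
      (continuous_besselWeight d)).aestronglyMeasurable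
  · filter_upwards with s
    rw [Real.norm_of_nonneg (mul_nonneg (Real.exp_pos _).le (besselWeight_pos d s).le)]
    have h1 : √(1 + s ^ 2) ≤ 1 + s ^ 2 := by
      rw [Real.sqrt_le_left (by positivity)]
      nlinarith [sq_nonneg s]
    calc _ ≤ Real.exp (-(t * s ^ 2)) * (4 * (1 + s ^ 2)) := by
          gcongr
          linarith [besselWeight_le_sqrt hd₁ hd₂ s]
      _ = _ := by simp only [Pi.add_apply]; ring

theorem integrableOn_sqrt_mul_exp_neg {c : ℝ} (hc : 0 < c) :
    IntegrableOn (fun r => √r * Real.exp (-(r * c ^ 2))) (Ioi 0) := by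
  have := integrableOn_rpow_mul_exp_neg_mul (x := 3 / 2) (by norm_num) (sq_pos_of_pos hc)
  refine this.congr_fun (fun r _ => ?_) measurableSet_Ioi
  beta_reduce
  rw [show (3 / 2 : ℝ) - 1 = 1 / 2 by norm_num, ← Real.sqrt_eq_rpow, mul_comm r]

theorem integral_sqrt_mul_exp_neg {c : ℝ} (hc : 0 < c) :
    ∫ r in Ioi (0 : ℝ), √r * Real.exp (-(r * c ^ 2)) = √Real.pi / 2 * (1 / c ^ 3) := by
  have := Real.integral_rpow_mul_exp_neg_mul_Ioi (a := 3 / 2) (by norm_num) (sq_pos_of_pos hc)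
  rw [show (3 / 2 : ℝ) - 1 = 1 / 2 by norm_num, show (3 / 2 : ℝ) = 1 / 2 + 1 by norm_num,
    Real.Gamma_add_one (by norm_num), Real.Gamma_one_half_eq] at this
  simp only [← Real.sqrt_eq_rpow, mul_comm (c ^ 2)] at this
  rw [this, one_div, Real.inv_rpow (by positivity), ← Real.rpow_natCast, ← Real.rpow_mul hc.le,
    show ((2 : ℕ) : ℝ) * (1 / 2 + 1) = (3 : ℕ) by norm_num, Real.rpow_natCast]
  ring

theorem integrable_sqrt_mul_exp_mul_besselWeight {d : ℝ} (hd₁ : -(1 / 2) < d)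
    (hd₂ : d < 1 / 2) :
    Integrable (fun p : ℝ × ℝ => √p.1 * Real.exp (-(p.1 * √(1 + p.2 ^ 2) ^ 2)) *
      besselWeight d p.2) ((volume.restrict (Ioi 0)).prod volume) := by
  have hcont := continuous_besselWeight d
  rw [integrable_prod_iff' (Continuous.aestronglyMeasurable (by fun_prop))]
  constructor
  · filter_upwards with s
    exact (integrableOn_sqrt_mul_exp_neg (by positivity)).mul_const _
  · refine ((integrable_besselWeight_div_cube hd₁ hd₂).const_mul (√Real.pi / 2)).congr ?_
    filter_upwards with s
    have hn : ∀ r : ℝ, ‖√r * Real.exp (-(r * √(1 + s ^ 2) ^ 2)) * besselWeight d s‖ =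
        √r * Real.exp (-(r * √(1 + s ^ 2) ^ 2)) * besselWeight d s := fun r =>
      Real.norm_of_nonneg (mul_nonneg (by positivity) (besselWeight_pos d s).le)
    simp only [hn]
    rw [integral_mul_const, integral_sqrt_mul_exp_neg (by positivity)]
    ring

/-- The solution `√(t / π) ∫ e ^ (-t s²) h(s) ds`, i.e. `√(t / π) e ^ (t / 2) K_{d + 1 / 2}(t / 2)`
for the modified Bessel function `K`. -/
noncomputable def besselSolution (d t : ℝ) : ℝ :=
  √(t / Real.pi) * ∫ s, Real.exp (-(t * s ^ 2)) * besselWeight d s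

theorem besselSolution_nonneg (d t : ℝ) : 0 ≤ besselSolution d t :=
  mul_nonneg (Real.sqrt_nonneg _)
    (integral_nonneg fun s => mul_nonneg (Real.exp_pos _).le (besselWeight_pos d s).le)

/-- The factor `e ^ (-r)` turns `s²` into `1 + s²` in the exponent. No sign of `r` is needed, since
`√r = 0` for negative `r`. -/
theorem besselSolution_mul_exp_neg (d : ℝ) (r : ℝ) :
    besselSolution d r * Real.exp (-r) =
      (√Real.pi)⁻¹ * ∫ s, √r * Real.exp (-(r * √(1 + s ^ 2) ^ 2)) * besselWeight d s := by
  have h : ∀ s : ℝ, √r * Real.exp (-(r * √(1 + s ^ 2) ^ 2)) * besselWeight d s =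
      √r * Real.exp (-r) * (Real.exp (-(r * s ^ 2)) * besselWeight d s) := fun s => by
    rw [Real.sq_sqrt (by positivity), show -(r * (1 + s ^ 2)) = -r + -(r * s ^ 2) by ring,
      Real.exp_add]
    ring
  simp only [h]
  rw [integral_const_mul, besselSolution, Real.sqrt_div' _ Real.pi_pos.le]
  ring

theorem integrableOn_besselSolution_mul_exp {d : ℝ} (hd₁ : -(1 / 2) < d) (hd₂ : d < 1 / 2) :
    IntegrableOn (fun r => besselSolution d r * Real.exp (-r)) (Ioi 0) := by
  simp only [besselSolution_mul_exp_neg]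
  exact (integrable_sqrt_mul_exp_mul_besselWeight hd₁ hd₂).integral_prod_left.const_mul _

theorem integral_besselSolution_mul_exp {d : ℝ} (hd₁ : -(1 / 2) < d) (hd₂ : d < 1 / 2)
    (hd₀ : d ≠ 0) :
    ∫ r in Ioi (0 : ℝ), besselSolution d r * Real.exp (-r) =
      Real.pi / Real.sin (Real.pi * d) * (d * (1 + d)) := by
  simp only [besselSolution_mul_exp_neg]
  rw [integral_const_mul, integral_integral_swap (f := fun r s : ℝ =>
    √r * Real.exp (-(r * √(1 + s ^ 2) ^ 2)) * besselWeight d s)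
    (integrable_sqrt_mul_exp_mul_besselWeight hd₁ hd₂)]
  have h : ∀ s : ℝ, ∫ r in Ioi (0 : ℝ), √r * Real.exp (-(r * √(1 + s ^ 2) ^ 2)) *
      besselWeight d s = √Real.pi / 2 * (besselWeight d s * (1 / √(1 + s ^ 2) ^ 3)) := fun s => by
    rw [integral_mul_const, integral_sqrt_mul_exp_neg (by positivity)]
    ring
  simp only [h]
  rw [integral_const_mul, integral_besselWeight_div_cube (by linarith) (by linarith) hd₀]
  have : 0 < √Real.pi := Real.sqrt_pos.2 Real.pi_pos
  field_simp

/-- Substituting `r = t σ² / c²` restores the Gaussian `e ^ (-t σ²)`; evenness in `σ` extends the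
integral to the whole line. -/
theorem integral_sqrt_mul_exp_neg_div_add {c t : ℝ} (hc : 0 < c) (ht : 0 < t) :
    ∫ r in Ioi (0 : ℝ), √r * Real.exp (-(r * c ^ 2)) / (r + t) =
      √t * ∫ σ : ℝ, Real.exp (-(t * σ ^ 2)) * σ ^ 2 * (1 / (c * (σ ^ 2 + c ^ 2))) := by
  have himg : (fun σ : ℝ => t / c ^ 2 * σ ^ 2) '' Ioi 0 = Ioi 0 := by
    ext r
    constructor
    · rintro ⟨σ, hσ, rfl⟩
      have hσ : 0 < σ := hσ
      exact mem_Ioi.2 (by positivity)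
    · intro hr
      have hr : 0 < r := hr
      refine ⟨√(r * c ^ 2 / t), mem_Ioi.2 (by positivity), ?_⟩
      dsimp only
      rw [Real.sq_sqrt (by positivity)]
      field_simp
  have heven := integral_comp_abs (f := fun σ : ℝ =>
    Real.exp (-(t * σ ^ 2)) * σ ^ 2 * (1 / (c * (σ ^ 2 + c ^ 2))))
  simp only [sq_abs] at heven
  rw [heven, ← integral_const_mul, ← integral_const_mul]
  conv_lhs => rw [← himg]
  rw [integral_image_eq_integral_abs_deriv_smul (f' := fun σ => t / c ^ 2 * (2 * σ))
    measurableSet_Ioi]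
  · refine setIntegral_congr_fun measurableSet_Ioi fun σ hσ => ?_
    have hσ : 0 < σ := hσ
    have hst : 0 < √t := Real.sqrt_pos.2 ht
    have h1 : √(t / c ^ 2 * σ ^ 2) = √t * σ / c := by
      rw [Real.sqrt_mul (by positivity), Real.sqrt_div ht.le, Real.sqrt_sq hc.le,
        Real.sqrt_sq hσ.le]
      ring
    have h2 : t / c ^ 2 * σ ^ 2 * c ^ 2 = t * σ ^ 2 := by field_simp
    have h3 : t / c ^ 2 * σ ^ 2 + t = t * (σ ^ 2 + c ^ 2) / c ^ 2 := by field_simp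
    rw [smul_eq_mul, abs_of_nonneg (by positivity), h1, h2, h3]
    field_simp
  · intro σ _
    simpa using (((hasDerivAt_id σ).pow 2).const_mul (t / c ^ 2)).hasDerivWithinAt
  · intro a ha b hb hab
    have ha : 0 < a := ha
    have hb : 0 < b := hb
    have h := mul_left_cancel₀ (by positivity) hab
    exact (pow_left_inj₀ ha.le hb.le two_ne_zero).1 h

/-- Dropping `σ²` from the denominator bounds the kernel by a product of integrable functions of one
variable each. -/
theorem integrable_resolventKernel {d t : ℝ} (hd₁ : -(1 / 2) < d) (hd₂ : d < 1 / 2)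
    (ht : 0 < t) :
    Integrable (fun p : ℝ × ℝ => besselWeight d p.1 * (Real.exp (-(t * p.2 ^ 2)) * p.2 ^ 2 *
      (1 / (√(1 + p.1 ^ 2) * (p.2 ^ 2 + √(1 + p.1 ^ 2) ^ 2))))) (volume.prod volume) := by
  have h2 : Integrable fun s : ℝ => s ^ 2 * Real.exp (-(t * s ^ 2)) := by
    simpa using integrable_rpow_mul_exp_neg_mul_sq ht (s := 2) (by norm_num)
  refine ((integrable_besselWeight_div_cube hd₁ hd₂).mul_prod h2).mono' ?_ ?_
  · refine Measurable.aestronglyMeasurable ?_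
    have := (continuous_besselWeight d).measurable
    fun_prop
  · filter_upwards with p
    have hp : 0 < √(1 + p.1 ^ 2) := by positivity
    have hw := besselWeight_pos d p.1
    rw [Real.norm_of_nonneg (by positivity)]
    calc _ ≤ besselWeight d p.1 * (Real.exp (-(t * p.2 ^ 2)) * p.2 ^ 2 *
          (1 / (√(1 + p.1 ^ 2) * (0 + √(1 + p.1 ^ 2) ^ 2)))) := by
          gcongr
          positivity
      _ = _ := by field_simp; ring

theorem integral_kernel_mul_besselSolution {d t : ℝ} (hd₁ : -(1 / 2) < d) (hd₂ : d < 1 / 2)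
    (ht : 0 < t) :
    ∫ r in Ioi (0 : ℝ), Real.exp (-r) / (r + t) * besselSolution d r =
      √(t / Real.pi) * ∫ σ : ℝ, Real.exp (-(t * σ ^ 2)) * (σ ^ 2 * ∫ s, besselWeight d s *
        (1 / (√(1 + s ^ 2) * (σ ^ 2 + √(1 + s ^ 2) ^ 2)))) := by
  have hcont := continuous_besselWeight d
  have h1 : ∀ r : ℝ, Real.exp (-r) / (r + t) * besselSolution d r = (√Real.pi)⁻¹ *
      ∫ s, √r * Real.exp (-(r * √(1 + s ^ 2) ^ 2)) / (r + t) * besselWeight d s := fun r => by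
    rw [div_mul_eq_mul_div, mul_comm, besselSolution_mul_exp_neg, mul_div_assoc, ← integral_div]
    congr 2
    ext s
    ring
  have hint : Integrable (fun p : ℝ × ℝ => √p.1 * Real.exp (-(p.1 * √(1 + p.2 ^ 2) ^ 2)) /
      (p.1 + t) * besselWeight d p.2) ((volume.restrict (Ioi 0)).prod volume) := by
    refine ((integrable_sqrt_mul_exp_mul_besselWeight hd₁ hd₂).const_mul t⁻¹).mono' ?_ ?_
    · refine Measurable.aestronglyMeasurable ?_
      have := hcont.measurable
      fun_prop
    · have hae : ∀ᵐ p : ℝ × ℝ ∂(volume.restrict (Ioi 0)).prod volume, p.1 ∈ Ioi (0 : ℝ) :=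
        Measure.quasiMeasurePreserving_fst.ae (ae_restrict_mem measurableSet_Ioi)
      filter_upwards [hae] with p hp
      have hp : 0 < p.1 := hp
      have hw := besselWeight_pos d p.2
      rw [Real.norm_of_nonneg (by positivity)]
      calc _ ≤ √p.1 * Real.exp (-(p.1 * √(1 + p.2 ^ 2) ^ 2)) / (0 + t) * besselWeight d p.2 := by
            gcongr
        _ = _ := by rw [zero_add]; ring
  have h2 : ∀ s : ℝ, ∫ r in Ioi (0 : ℝ), √r * Real.exp (-(r * √(1 + s ^ 2) ^ 2)) / (r + t) *
      besselWeight d s = √t * ∫ σ : ℝ, besselWeight d s * (Real.exp (-(t * σ ^ 2)) * σ ^ 2 *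
      (1 / (√(1 + s ^ 2) * (σ ^ 2 + √(1 + s ^ 2) ^ 2)))) := fun s => by
    rw [integral_mul_const, integral_sqrt_mul_exp_neg_div_add (by positivity) ht,
      integral_const_mul]
    ring
  simp only [h1]
  rw [integral_const_mul, integral_integral_swap (f := fun r s : ℝ =>
    √r * Real.exp (-(r * √(1 + s ^ 2) ^ 2)) / (r + t) * besselWeight d s) hint]
  simp only [h2]
  rw [integral_const_mul, integral_integral_swap (f := fun s σ : ℝ => besselWeight d s *
    (Real.exp (-(t * σ ^ 2)) * σ ^ 2 * (1 / (√(1 + s ^ 2) * (σ ^ 2 + √(1 + s ^ 2) ^ 2)))))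
    (integrable_resolventKernel hd₁ hd₂ ht), ← mul_assoc, Real.sqrt_div ht.le, inv_mul_eq_div]
  congr 2
  ext σ
  rw [← mul_assoc, ← integral_const_mul]
  congr 1
  ext s
  ring

theorem sin_pi_mul_ne_zero_of_abs_lt_one {d : ℝ} (hd₁ : -1 < d) (hd₂ : d < 1) (hd₀ : d ≠ 0) :
    Real.sin (Real.pi * d) ≠ 0 := by
  have hπ := Real.pi_pos
  rw [Ne, Real.sin_eq_zero_iff_of_lt_of_lt (by nlinarith) (by nlinarith)]
  exact mul_ne_zero hπ.ne' hd₀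

theorem besselSolution_eq {d t : ℝ} (hd₁ : -(1 / 2) < d) (hd₂ : d < 1 / 2) (hd₀ : d ≠ 0)
    (ht : 0 < t) :
    besselSolution d t = Real.sin (Real.pi * d) / Real.pi *
      (∫ r in Ioi (0 : ℝ), Real.exp (-r) / (r + t) * besselSolution d r) + 1 := by
  have hsin := sin_pi_mul_ne_zero_of_abs_lt_one (by linarith) (by linarith) hd₀
  have hi := integrable_exp_mul_besselWeight hd₁ hd₂ ht
  have hi' : Integrable fun s => Real.exp (-(t * s ^ 2)) * besselWeight d (-s) := by
    simpa using hi.comp_neg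
  have hg : Integrable fun s : ℝ => Real.exp (-(t * s ^ 2)) := by
    simpa using integrable_exp_neg_mul_sq ht
  have hneg : ∫ s, Real.exp (-(t * s ^ 2)) * besselWeight d (-s) =
      ∫ s, Real.exp (-(t * s ^ 2)) * besselWeight d s := by
    rw [← integral_neg_eq_self (fun s => Real.exp (-(t * s ^ 2)) * besselWeight d s) volume]
    refine integral_congr_ae (ae_of_all _ fun s => ?_)
    beta_reduce
    rw [neg_sq]
  have hgauss : ∫ s : ℝ, Real.exp (-(t * s ^ 2)) = √(Real.pi / t) := by
    simpa using integral_gaussian t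
  have h1 : ∀ σ : ℝ, Real.sin (Real.pi * d) / Real.pi * (Real.exp (-(t * σ ^ 2)) *
      (σ ^ 2 * ∫ s, besselWeight d s *
        (1 / (√(1 + s ^ 2) * (σ ^ 2 + √(1 + s ^ 2) ^ 2))))) =
      (1 / 2) * (Real.exp (-(t * σ ^ 2)) * besselWeight d σ) +
      (1 / 2) * (Real.exp (-(t * σ ^ 2)) * besselWeight d (-σ)) -
      Real.exp (-(t * σ ^ 2)) := fun σ => by
    rw [mul_left_comm, integral_besselWeight_resolvent (by linarith) (by linarith) hd₀ hsin]
    ring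
  have hsum : Integrable fun σ => (1 / 2) * (Real.exp (-(t * σ ^ 2)) * besselWeight d σ) +
      (1 / 2) * (Real.exp (-(t * σ ^ 2)) * besselWeight d (-σ)) :=
    (hi.const_mul _).add (hi'.const_mul _)
  rw [integral_kernel_mul_besselSolution hd₁ hd₂ ht, mul_left_comm, ← integral_const_mul]
  simp only [h1]
  rw [integral_sub hsum hg, integral_add (hi.const_mul _) (hi'.const_mul _), integral_const_mul,
    integral_const_mul, hneg, hgauss, mul_sub, ← Real.sqrt_mul (by positivity),
    show t / Real.pi * (Real.pi / t) = 1 by field_simp, Real.sqrt_one, besselSolution]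
  ring

/-! ### Square integrability at `0` and at infinity. -/

/-- The weight is at most `4 t ^ (-|d|) (1 + t s²)`, and half of the Gaussian exponent absorbs `1 +
t s²`. The other half integrates to `√(2π / t)`, which leaves `√2`. -/
theorem besselSolution_le_rpow {d t : ℝ} (hd₁ : -(1 / 2) < d) (hd₂ : d < 1 / 2)
    (ht : 0 < t) (ht1 : t ≤ 1) : besselSolution d t ≤ 8 * √2 * t ^ (-|d|) := by
  have hπ := Real.pi_pos
  have hgi : Integrable fun s : ℝ => Real.exp (-(t / 2 * s ^ 2)) := by
    simpa using integrable_exp_neg_mul_sq (half_pos ht)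
  have hgauss : ∫ s : ℝ, Real.exp (-(t / 2 * s ^ 2)) = √(Real.pi / (t / 2)) := by
    simpa using integral_gaussian (t / 2)
  have hpt : ∀ s : ℝ, Real.exp (-(t * s ^ 2)) * besselWeight d s ≤
      8 * t ^ (-|d|) * Real.exp (-(t / 2 * s ^ 2)) := fun s => by
    have h1 : (1 + s ^ 2) ^ d ≤ t ^ (-|d|) * (1 + t * s ^ 2) := by
      calc (1 + s ^ 2) ^ d ≤ (1 + s ^ 2) ^ |d| := by
            gcongr
            · nlinarith [sq_nonneg s]
            · exact le_abs_self d
        _ ≤ (t⁻¹ * (1 + t * s ^ 2)) ^ |d| := by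
            gcongr
            rw [mul_add, mul_one, inv_mul_cancel_left₀ ht.ne']
            gcongr
            exact (one_le_inv₀ ht).2 ht1
        _ = t ^ (-|d|) * (1 + t * s ^ 2) ^ |d| := by
            rw [Real.mul_rpow (by positivity) (by positivity), Real.inv_rpow ht.le,
              Real.rpow_neg ht.le]
        _ ≤ t ^ (-|d|) * (1 + t * s ^ 2) ^ (1 : ℝ) := by
            gcongr
            · have : 0 ≤ t * s ^ 2 := by positivity
              linarith
            · rw [abs_le]; constructor <;> linarith
        _ = _ := by rw [Real.rpow_one]
    have h2 : 1 + t * s ^ 2 ≤ 2 * Real.exp (t / 2 * s ^ 2) := by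
      have := Real.add_one_le_exp (t / 2 * s ^ 2)
      linarith
    calc Real.exp (-(t * s ^ 2)) * besselWeight d s
        ≤ Real.exp (-(t * s ^ 2)) * (4 * (t ^ (-|d|) * (2 * Real.exp (t / 2 * s ^ 2)))) := by
          gcongr
          refine (besselWeight_le hd₁ hd₂ s).trans ?_
          gcongr
          exact h1.trans (by gcongr)
      _ = 8 * t ^ (-|d|) * (Real.exp (-(t * s ^ 2)) * Real.exp (t / 2 * s ^ 2)) := by ring
      _ = _ := by rw [← Real.exp_add]; ring_nf
  calc besselSolution d t
      ≤ √(t / Real.pi) * ∫ s : ℝ, 8 * t ^ (-|d|) * Real.exp (-(t / 2 * s ^ 2)) := by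
        unfold besselSolution
        exact mul_le_mul_of_nonneg_left (integral_mono
          (integrable_exp_mul_besselWeight hd₁ hd₂ ht) (hgi.const_mul _) hpt) (Real.sqrt_nonneg _)
    _ = 8 * (√(t / Real.pi) * √(Real.pi / (t / 2))) * t ^ (-|d|) := by
        rw [integral_const_mul, hgauss]
        ring
    _ = _ := by
        rw [← Real.sqrt_mul (by positivity), show t / Real.pi * (Real.pi / (t / 2)) = 2 by
          field_simp]

theorem measurable_besselSolution (d : ℝ) : Measurable (besselSolution d) := by
  have h : StronglyMeasurable fun t : ℝ => ∫ s, Real.exp (-(t * s ^ 2)) * besselWeight d s := by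
    refine StronglyMeasurable.integral_prod_right (f := fun t s : ℝ =>
      Real.exp (-(t * s ^ 2)) * besselWeight d s) ?_
    have := continuous_besselWeight d
    exact Continuous.stronglyMeasurable (by fun_prop)
  have := h.measurable
  unfold besselSolution
  fun_prop

/-- Decay is read off the integral equation itself, using `1 / (r + t) ≤ 1 / t`. -/
theorem abs_besselSolution_sub_one_le {d t : ℝ} (hd₁ : -(1 / 2) < d) (hd₂ : d < 1 / 2)
    (hd₀ : d ≠ 0) (ht : 0 < t) :
    |besselSolution d t - 1| ≤ |Real.sin (Real.pi * d) / Real.pi| *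
      (∫ r in Ioi (0 : ℝ), besselSolution d r * Real.exp (-r)) * t⁻¹ := by
  rw [besselSolution_eq hd₁ hd₂ hd₀ ht, add_sub_cancel_right, abs_mul, mul_assoc,
    ← integral_mul_const]
  gcongr
  rw [← Real.norm_eq_abs]
  refine norm_integral_le_of_norm_le
    ((integrableOn_besselSolution_mul_exp hd₁ hd₂).mul_const t⁻¹) ?_
  filter_upwards [ae_restrict_mem measurableSet_Ioi] with r hr
  have hr : 0 < r := hr
  have hq := besselSolution_nonneg d r
  rw [Real.norm_of_nonneg (by positivity), div_eq_mul_inv, mul_right_comm,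
    mul_comm (Real.exp (-r))]
  gcongr
  linarith

theorem memLp_besselSolution_sub_one {d : ℝ} (hd₁ : -(1 / 2) < d) (hd₂ : d < 1 / 2)
    (hd₀ : d ≠ 0) :
    MemLp (fun t => besselSolution d t - 1) 2 (volume.restrict (Ioi (0 : ℝ))) := by
  have hm : Measurable fun t => besselSolution d t - 1 := (measurable_besselSolution d).sub_const 1
  rw [memLp_two_iff_integrable_sq hm.aestronglyMeasurable, ← Ioc_union_Ioi_eq_Ioi zero_le_one]
  refine IntegrableOn.union ?_ ?_
  · have hint : IntegrableOn (fun t : ℝ => (1 + 8 * √2) ^ 2 * t ^ (-(2 * |d|))) (Ioc 0 1) := by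
      refine Integrable.const_mul ?_ _
      -- This makes the squared bound `t ^ (-2|d|)` integrable at `0`.
      have : |d| < 1 / 2 := abs_lt.2 ⟨hd₁, hd₂⟩
      exact (intervalIntegrable_iff_integrableOn_Ioc_of_le zero_le_one).1
        (intervalIntegral.intervalIntegrable_rpow' (by linarith))
    refine hint.mono' (hm.pow_const 2).aestronglyMeasurable ?_
    filter_upwards [ae_restrict_mem measurableSet_Ioc] with t ht
    have hq := besselSolution_nonneg d t
    have hq' := besselSolution_le_rpow hd₁ hd₂ ht.1 ht.2
    have h1 : 1 ≤ t ^ (-|d|) :=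
      Real.one_le_rpow_of_pos_of_le_one_of_nonpos ht.1 ht.2 (by simp)
    have h2 : |besselSolution d t - 1| ≤ (1 + 8 * √2) * t ^ (-|d|) := by
      rw [abs_le]
      constructor <;> nlinarith
    rw [Real.norm_of_nonneg (sq_nonneg _), ← sq_abs,
      show -(2 * |d|) = -|d| + -|d| by ring, Real.rpow_add ht.1, ← sq, ← mul_pow]
    gcongr
  · set C := |Real.sin (Real.pi * d) / Real.pi| *
      (∫ r in Ioi (0 : ℝ), besselSolution d r * Real.exp (-r))
    have hint : IntegrableOn (fun t : ℝ => C ^ 2 * t ^ (-2 : ℝ)) (Ioi 1) :=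
      (integrableOn_Ioi_rpow_of_lt (by norm_num) one_pos).const_mul _
    refine hint.mono' (hm.pow_const 2).aestronglyMeasurable ?_
    filter_upwards [ae_restrict_mem measurableSet_Ioi] with t ht
    have ht0 : 0 < t := one_pos.trans ht
    have h := abs_besselSolution_sub_one_le hd₁ hd₂ hd₀ ht0
    rw [Real.norm_of_nonneg (sq_nonneg _), ← sq_abs, Real.rpow_neg ht0.le, Real.rpow_two,
      ← inv_pow, ← mul_pow]
    gcongr

/-! ### Conclusion. -/

theorem isUniqueHalfLineSolution_besselSolution {d : ℝ} (hd₁ : -(1 / 2) < d) (hd₂ : d < 1 / 2)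
    (hd₀ : d ≠ 0) :
    IsUniqueHalfLineSolution (Real.sin (Real.pi * d) / Real.pi) (besselSolution d) := by
  have hπ := Real.pi_pos
  have hsol : IsHalfLineSolution (Real.sin (Real.pi * d) / Real.pi) (besselSolution d) :=
    ⟨memLp_besselSolution_sub_one hd₁ hd₂ hd₀, fun t ht => besselSolution_eq hd₁ hd₂ hd₀ ht⟩
  refine ⟨hsol, fun g hg => hsol.eqOn ?_ hg⟩
  -- The contraction constant is `|sin (π d)|`, below `1` because `|π d| < π / 2`.
  rw [abs_div, abs_of_pos hπ, div_mul_cancel₀ _ hπ.ne', abs_lt]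
  constructor
  · rw [← Real.sin_pi_div_two, ← Real.sin_neg]
    exact Real.sin_lt_sin_of_lt_of_le_pi_div_two le_rfl (by nlinarith) (by nlinarith)
  · rw [← Real.sin_pi_div_two]
    exact Real.sin_lt_sin_of_lt_of_le_pi_div_two (by nlinarith) le_rfl (by nlinarith)

theorem theorem6p2 (d : ℝ) (hd₁ : -(1 / 2) < d) (hd₂ : d < 1 / 2) (hd₀ : d ≠ 0) :
    ∃ q₁ p₁ : ℝ → ℝ,
      IsUniqueHalfLineSolution (Real.sin (Real.pi * d) / Real.pi) q₁ ∧
      IsUniqueHalfLineSolution (-(Real.sin (Real.pi * d) / Real.pi)) p₁ ∧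
      IntegrableOn (fun τ => q₁ τ * Real.exp (-τ)) (Ioi (0 : ℝ)) ∧
      IntegrableOn (fun τ => p₁ τ * Real.exp (-τ)) (Ioi (0 : ℝ)) ∧
      (∫ τ in Ioi (0 : ℝ), q₁ τ * Real.exp (-τ)) =
        Real.pi / Real.sin (Real.pi * d) * (d * (1 + d)) ∧
      (∫ τ in Ioi (0 : ℝ), p₁ τ * Real.exp (-τ)) =
        Real.pi / Real.sin (Real.pi * d) * (d * (1 - d)) := by
  have h₁ : -(1 / 2) < -d := by linarith
  have h₂ : -d < 1 / 2 := by linarith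
  have h₀ : -d ≠ 0 := neg_ne_zero.2 hd₀
  refine ⟨besselSolution d, besselSolution (-d),
    isUniqueHalfLineSolution_besselSolution hd₁ hd₂ hd₀, ?_,
    integrableOn_besselSolution_mul_exp hd₁ hd₂, integrableOn_besselSolution_mul_exp h₁ h₂,
    integral_besselSolution_mul_exp hd₁ hd₂ hd₀, ?_⟩
  · simpa [neg_div] using isUniqueHalfLineSolution_besselSolution h₁ h₂ h₀
  · rw [integral_besselSolution_mul_exp h₁ h₂ h₀, mul_neg, Real.sin_neg, div_neg]
    ring
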